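/- Let $n,m\ge 0$ be integers, let $\mathbb R^n$, $\mathbb R^m$ carry their Euclidean inner products $\langle\cdot,\cdot\rangle$ and norms $\|\cdot\|$, and let $F:\mathbb R^n\times\mathbb R^m\to\mathbb R\cup\{+\infty\}$ be a closed proper convex function (that is, $F$ is lower semicontinuous, convex, and not identically $+\infty$). Its subdifferential $\partial F(x,u)$ is the set of all $(s,q)\in\mathbb R^n\times\mathbb R^m$ with $F(x',u')\ge F(x,u)+\langle s,x'-x\rangle+\langle q,u'-u\rangle$ for all $(x',u')$, and its Lagrangian is $$L(x,p)=\inf_{u\in\mathbb R^m}\{F(x,u)-\langle u,p\rangle\}\in[-\infty,+\infty].$$ A saddle point of $L$ is a pair $(x^*,p^*)$ such that $L(x^*,p)\le L(x^*,p^*)\le L(x,p^*)$ for all $x\in\mathbb R^n$ and $p\in\mathbb R^m$. Let $\epsilon\in(0,1)$, let $\{c_k\}_{k\ge0},\{\rho_k\}_{k\ge0}\subset\mathbb R$ with $\inf_k c_k>0$, and let $\{x^k\}_{k\ge1},\{w^k\}_{k\ge0},\{s^k\}_{k\ge1}\subset\mathbb R^n$ and $\{p^k\}_{k\ge0},\{\bar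 p^k\}_{k\ge0},\{u^k\}_{k\ge1}\subset\mathbb R^m$ be sequences such that for all $k\ge0$ \begin{align*} (s^{k+1},0)&\in\partial F(x^{k+1},u^{k+1})+(0,\,c_ku^{k+1}-p^k),\\ \rho_k\Big(\frac{2}{c_k}\Big)\big|\langle x^{k+1}-w^k,s^{k+1}\rangle\big|+\rho_k^2\|s^{k+1}\|^2&\le(2\rho_k-\rho_k^2-\epsilon)\|u^{k+1}\|^2,\\ 2\rho_k-\rho_k^2-\epsilon&\ge0,\\ w^{k+1}&=w^k-\rho_kc_ks^{k+1},\\ \bar p^k&=p^k-c_ku^{k+1},\\ p^{k+1}&=(1-\rho_k)p^k+\rho_k\bar p^k. \end{align*} If $L$ has no saddle point, then at least one of the sequences $\{x^k\}_{k\ge1}$ and $\{\bar p^k\}_{k\ge0}$ is unbounded. -/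

import Mathlib

open scoped Pointwise

/-- `F : ℝⁿ × ℝᵐ → ℝ ∪ {+∞}` is a closed proper convex function: it never takes the value `-∞`, is
not identically `+∞`, is lower semicontinuous, and has a convex epigraph. -/
structure IsClosedProperConvex {n m : ℕ}
    (F : EuclideanSpace ℝ (Fin n) × EuclideanSpace ℝ (Fin m) → EReal) : Prop where
  ne_bot : ∀ z, F z ≠ ⊥
  exists_ne_top : ∃ z, F z ≠ ⊤
  lowerSemicontinuous : LowerSemicontinuous F
  convex_epigraph : Convex ℝ
    {q : (EuclideanSpace ℝ (Fin n) × EuclideanSpace ℝ (Fin m)) × ℝ | F q.1 ≤ (q.2 : EReal)}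

/-- The subdifferential `∂F(x, u)` of `F : ℝⁿ × ℝᵐ → ℝ ∪ {+∞}`, where `ℝⁿ × ℝᵐ` carries the inner
product `⟨(s, p), (x, u)⟩ = ⟨s, x⟩ + ⟨p, u⟩`. -/
def subdifferential {n m : ℕ}
    (F : EuclideanSpace ℝ (Fin n) × EuclideanSpace ℝ (Fin m) → EReal)
    (x : EuclideanSpace ℝ (Fin n)) (u : EuclideanSpace ℝ (Fin m)) :
    Set (EuclideanSpace ℝ (Fin n) × EuclideanSpace ℝ (Fin m)) :=
  {g | ∀ (x' : EuclideanSpace ℝ (Fin n)) (u' : EuclideanSpace ℝ (Fin m)),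
    F (x, u) + ((inner ℝ g.1 (x' - x) + inner ℝ g.2 (u' - u) : ℝ) : EReal) ≤ F (x', u')}

/-- The Lagrangian `L(x, p) = inf_u {F(x, u) - ⟨u, p⟩}`, with values in `[-∞, +∞]`. -/
noncomputable def lagrangian {n m : ℕ}
    (F : EuclideanSpace ℝ (Fin n) × EuclideanSpace ℝ (Fin m) → EReal)
    (x : EuclideanSpace ℝ (Fin n)) (p : EuclideanSpace ℝ (Fin m)) : EReal :=
  ⨅ u : EuclideanSpace ℝ (Fin m), (F (x, u) - ((inner ℝ u p : ℝ) : EReal))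

/-! Suppose both sequences are bounded. Averages with weights `l k = ρ k * c k` then yield a saddle
point. Both `w` and `p` move by `l k` times a vector, so for every `x'` the quantity `‖w - x'‖² +
‖p‖²` telescopes and bounds the weighted sum of duality pairings (`norm_sq_add_norm_sq_step_le`); no
solution need exist. The total weight `Λ N` tends to infinity, so the averaged pairing vanishes in
the limit, and so does the average of `u`, since `p` is bounded (`exists_norm_le_of_relaxation`). By
compactness and `apply_centerMass_le`, a cluster point `(a, b)` satisfies `(0, b) ∈ ∂F(a, 0)`. -/

/-- The real epigraph of a lower semicontinuous extended-real-valued function is closed. -/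
theorem LowerSemicontinuous.isClosed_real_epigraph {α : Type*} [TopologicalSpace α]
    {f : α → EReal} (hf : LowerSemicontinuous f) :
    IsClosed {q : α × ℝ | f q.1 ≤ (q.2 : EReal)} :=
  hf.isClosed_epigraph.preimage
    (continuous_fst.prodMk (continuous_coe_real_ereal.comp continuous_snd))

/-- If `(0, p) ∈ ∂F(x, 0)` then `(x, p)` is a saddle point of the Lagrangian of `F`. -/
theorem isSaddlePointOn_lagrangian_of_mem_subdifferential {n m : ℕ}
    {F : EuclideanSpace ℝ (Fin n) × EuclideanSpace ℝ (Fin m) → EReal}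
    {x : EuclideanSpace ℝ (Fin n)} {p : EuclideanSpace ℝ (Fin m)}
    (h : (0, p) ∈ subdifferential F x 0) :
    IsSaddlePointOn Set.univ Set.univ (lagrangian F) x p := by
  intro x' _ p' _
  calc lagrangian F x p' ≤ F (x, 0) - ((inner ℝ 0 p' : ℝ) : EReal) := iInf_le _ 0
    _ = F (x, 0) := by simp
    _ ≤ lagrangian F x' p := le_iInf fun u => by
      have := h x' u
      simp only [inner_zero_left, sub_zero, zero_add] at this
      rw [real_inner_comm]
      exact EReal.le_sub_iff_add_le (.inl (EReal.coe_ne_bot _)) (.inl (EReal.coe_ne_top _)) |>.2 this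

/-- A subgradient exists only at points where a proper function is finite. -/
theorem IsClosedProperConvex.ne_top_of_mem_subdifferential {n m : ℕ}
    {F : EuclideanSpace ℝ (Fin n) × EuclideanSpace ℝ (Fin m) → EReal}
    (hF : IsClosedProperConvex F)
    {x : EuclideanSpace ℝ (Fin n)} {u : EuclideanSpace ℝ (Fin m)}
    {g : EuclideanSpace ℝ (Fin n) × EuclideanSpace ℝ (Fin m)}
    (h : g ∈ subdifferential F x u) : F (x, u) ≠ ⊤ := by
  obtain ⟨⟨x', u'⟩, hz⟩ := hF.exists_ne_top
  intro htop
  have := h x' u'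
  rw [htop, EReal.top_add_coe, top_le_iff] at this
  exact hz this

/-- One step of the relaxed inexact proximal iteration decreases the squared distance to `(a, 0)`
by at least twice the weighted duality pairing. -/
theorem norm_sq_add_norm_sq_step_le {V W : Type*}
    [NormedAddCommGroup V] [InnerProductSpace ℝ V] [NormedAddCommGroup W] [InnerProductSpace ℝ W]
    {ε c ρ : ℝ} {x w s : V} {p u : W} (hε : 0 ≤ ε) (hc : 0 < c) (hρ : 0 ≤ ρ)
    (h : ρ * (2 / c) * |inner ℝ (x - w) s| + ρ ^ 2 * ‖s‖ ^ 2 ≤ (2 * ρ - ρ ^ 2 - ε) * ‖u‖ ^ 2)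
    (a : V) :
    ‖w - (ρ * c) • s - a‖ ^ 2 + ‖p - (ρ * c) • u‖ ^ 2
        + 2 * (ρ * c) * (inner ℝ s (x - a) + inner ℝ (p - c • u) u)
      ≤ ‖w - a‖ ^ 2 + ‖p‖ ^ 2 := by
  have h₁ : ‖w - (ρ * c) • s - a‖ ^ 2
      = ‖w - a‖ ^ 2 - 2 * (ρ * c) * inner ℝ s (w - a) + (ρ * c) ^ 2 * ‖s‖ ^ 2 := by
    rw [sub_right_comm, norm_sub_sq_real, inner_smul_right, norm_smul, mul_pow, Real.norm_eq_abs,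
      sq_abs, real_inner_comm]
    ring
  have h₂ : ‖p - (ρ * c) • u‖ ^ 2
      = ‖p‖ ^ 2 - 2 * (ρ * c) * inner ℝ p u + (ρ * c) ^ 2 * ‖u‖ ^ 2 := by
    rw [norm_sub_sq_real, inner_smul_right, norm_smul, mul_pow, Real.norm_eq_abs, sq_abs]
    ring
  have h₃ : inner ℝ s (x - a) = inner ℝ (x - w) s + inner ℝ s (w - a) := by
    rw [real_inner_comm s (x - w), ← inner_add_right, sub_add_sub_cancel]
  have h₄ : inner ℝ (p - c • u) u = inner ℝ p u - c * ‖u‖ ^ 2 := by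
    rw [inner_sub_left, real_inner_smul_left, real_inner_self_eq_norm_sq]
  -- The error criterion times `c ^ 2`; the `ε` term it leaves over is nonnegative and is discarded.
  have h₅ : 2 * (ρ * c) * |inner ℝ (x - w) s| + (ρ * c) ^ 2 * ‖s‖ ^ 2
      ≤ (2 * ρ - ρ ^ 2 - ε) * c ^ 2 * ‖u‖ ^ 2 := by
    have := mul_le_mul_of_nonneg_left h (sq_nonneg c)
    have e : c ^ 2 * (ρ * (2 / c) * |inner ℝ (x - w) s| + ρ ^ 2 * ‖s‖ ^ 2)
        = 2 * (ρ * c) * |inner ℝ (x - w) s| + (ρ * c) ^ 2 * ‖s‖ ^ 2 := by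
      field_simp
    rw [e] at this
    linarith
  have h₆ : 2 * (ρ * c) * inner ℝ (x - w) s ≤ 2 * (ρ * c) * |inner ℝ (x - w) s| :=
    mul_le_mul_of_nonneg_left (le_abs_self _) (by positivity)
  have h₇ : 0 ≤ ε * c ^ 2 * ‖u‖ ^ 2 := by positivity
  rw [h₁, h₂, h₃, h₄]
  linarith

/-- Relaxed averages of a bounded sequence stay bounded when the relaxation factors are
uniformly inside `(0, 2)`. -/
theorem exists_norm_le_of_relaxation {W : Type*} [NormedAddCommGroup W] [NormedSpace ℝ W]
    {δ B : ℝ} {ρ : ℕ → ℝ} {p q : ℕ → W} (hδ : 0 < δ)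
    (hρ : ∀ k, |1 - ρ k| ≤ 1 - δ) (hq : ∀ k, ‖q k‖ ≤ B)
    (hp : ∀ k, p (k + 1) = (1 - ρ k) • p k + ρ k • q k) :
    ∃ M, ∀ k, ‖p k‖ ≤ M := by
  have hB : 0 ≤ B := (norm_nonneg _).trans (hq 0)
  -- `2 * B / δ` solves `(1 - δ) * M + 2 * B = M`, where `2` bounds `|ρ k|`.
  refine ⟨max ‖p 0‖ (2 * B / δ), fun k => ?_⟩
  induction k with
  | zero => exact le_max_left _ _
  | succ k ih =>
    set M := max ‖p 0‖ (2 * B / δ)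
    have hM : 2 * B ≤ M * δ := (div_le_iff₀ hδ).1 (le_max_right _ _)
    have hρ' : |ρ k| ≤ 2 := by
      have := abs_le.1 (hρ k)
      exact abs_le.2 ⟨by linarith, by linarith⟩
    calc ‖p (k + 1)‖ ≤ |1 - ρ k| * ‖p k‖ + |ρ k| * ‖q k‖ := by
          rw [hp, ← Real.norm_eq_abs, ← Real.norm_eq_abs, ← norm_smul, ← norm_smul]
          exact norm_add_le _ _
      _ ≤ (1 - δ) * M + 2 * B :=
          add_le_add
            (mul_le_mul (hρ k) ih (norm_nonneg _) ((abs_nonneg _).trans (hρ k)))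
            (mul_le_mul hρ' (hq k) (norm_nonneg _) zero_le_two)
      _ ≤ M := by linarith

/-- Averaging subgradient inequalities: a finite value `r` of `F` at `(x', u')` bounds the value of
`F` at a weighted mean of points, up to the weighted mean of the pairings. -/
theorem IsClosedProperConvex.apply_centerMass_le {n m : ℕ}
    {F : EuclideanSpace ℝ (Fin n) × EuclideanSpace ℝ (Fin m) → EReal}
    (hF : IsClosedProperConvex F) {ι : Type*} {t : Finset ι} {l : ι → ℝ}
    {x s : ι → EuclideanSpace ℝ (Fin n)} {u q : ι → EuclideanSpace ℝ (Fin m)}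
    (hl : ∀ i ∈ t, 0 ≤ l i) (hl' : 0 < ∑ i ∈ t, l i)
    (h : ∀ i, (s i, q i) ∈ subdifferential F (x i) (u i))
    {x' : EuclideanSpace ℝ (Fin n)} {u' : EuclideanSpace ℝ (Fin m)} {r : ℝ}
    (hr : F (x', u') = r) :
    F (t.centerMass l x, t.centerMass l u) ≤
      ((r - inner ℝ (t.centerMass l q) u'
        + (∑ i ∈ t, l i)⁻¹ * ∑ i ∈ t, l i * (inner ℝ (s i) (x i - x') + inner ℝ (q i) (u i)) : ℝ)
        : EReal) := by
  have hfin : ∀ i, F (x i, u i) = ((F (x i, u i)).toReal : EReal) := fun i =>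
    (EReal.coe_toReal (hF.ne_top_of_mem_subdifferential (h i)) (hF.ne_bot _)).symm
  have hmem := hF.convex_epigraph.centerMass_mem (z := fun i => ((x i, u i), (F (x i, u i)).toReal))
    hl hl' (fun i _ => (hfin i).le)
  have hz : t.centerMass l (fun i => ((x i, u i), (F (x i, u i)).toReal))
      = ((t.centerMass l x, t.centerMass l u),
          t.centerMass l fun i => (F (x i, u i)).toReal) := by
    simp only [Finset.centerMass, Prod.ext_iff, Prod.smul_fst, Prod.smul_snd, Prod.fst_sum,
      Prod.snd_sum, and_self]
  rw [hz] at hmem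
  refine le_trans hmem (EReal.coe_le_coe_iff.2 ?_)
  have hi : ∀ i, (F (x i, u i)).toReal
      ≤ r - inner ℝ (q i) u' + (inner ℝ (s i) (x i - x') + inner ℝ (q i) (u i)) := by
    intro i
    have := h i x' u'
    rw [hr, hfin i, ← EReal.coe_add, EReal.coe_le_coe_iff] at this
    simp only [inner_sub_right] at this ⊢
    linarith
  have hsum : ∑ i ∈ t, l i * (F (x i, u i)).toReal
      ≤ (∑ i ∈ t, l i) * r - inner ℝ (∑ i ∈ t, l i • q i) u'
        + ∑ i ∈ t, l i * (inner ℝ (s i) (x i - x') + inner ℝ (q i) (u i)) := by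
    rw [Finset.sum_mul, sum_inner, ← Finset.sum_sub_distrib, ← Finset.sum_add_distrib]
    refine Finset.sum_le_sum fun i hit => ?_
    rw [real_inner_smul_left]
    linarith [mul_le_mul_of_nonneg_left (hi i) (hl i hit)]
  have := mul_le_mul_of_nonneg_left hsum (inv_nonneg.2 hl'.le)
  simp only [Finset.centerMass, smul_eq_mul, real_inner_smul_left]
  rw [mul_add, mul_sub, inv_mul_cancel_left₀ hl'.ne'] at this
  exact this

theorem proposition3p3 {n m : ℕ}
    (F : EuclideanSpace ℝ (Fin n) × EuclideanSpace ℝ (Fin m) → EReal)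
    (hF : IsClosedProperConvex F)
    (ε : ℝ) (hε : ε ∈ Set.Ioo (0 : ℝ) 1)
    (c ρ : ℕ → ℝ) (hc : 0 < ⨅ k, c k)
    (x w s : ℕ → EuclideanSpace ℝ (Fin n))
    (p pbar u : ℕ → EuclideanSpace ℝ (Fin m))
    (h_min : ∀ k, (s (k + 1), (0 : EuclideanSpace ℝ (Fin m))) ∈
      subdifferential F (x (k + 1)) (u (k + 1)) +
        {((0 : EuclideanSpace ℝ (Fin n)), c k • u (k + 1) - p k)})
    (h_approx : ∀ k,
      ρ k * (2 / c k) * |inner ℝ (x (k + 1) - w k) (s (k + 1))|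
          + ρ k ^ 2 * ‖s (k + 1)‖ ^ 2
        ≤ (2 * ρ k - ρ k ^ 2 - ε) * ‖u (k + 1)‖ ^ 2)
    (h_eps : ∀ k, 0 ≤ 2 * ρ k - ρ k ^ 2 - ε)
    (h_w : ∀ k, w (k + 1) = w k - (ρ k * c k) • s (k + 1))
    (h_pbar : ∀ k, pbar k = p k - c k • u (k + 1))
    (h_p : ∀ k, p (k + 1) = (1 - ρ k) • p k + ρ k • pbar k)
    (h_saddle : ¬ ∃ (x₀ : EuclideanSpace ℝ (Fin n)) (p₀ : EuclideanSpace ℝ (Fin m)),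
      IsSaddlePointOn Set.univ Set.univ (lagrangian F) x₀ p₀) :
    ¬ Bornology.IsBounded (Set.range fun k => x (k + 1)) ∨
      ¬ Bornology.IsBounded (Set.range pbar) := by
  by_contra! hbdd
  obtain ⟨hx, hpb⟩ := hbdd
  obtain ⟨A, hA⟩ := hx.subset_closedBall 0
  obtain ⟨B, hB⟩ := hpb.subset_closedBall 0
  rw [Set.range_subset_iff] at hA hB
  have hε0 : 0 < ε := hε.1
  -- Without a lower bound the real infimum defaults to `0`, contradicting `hc`.
  have hbelow : BddBelow (Set.range c) := by
    by_contra hcon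
    rw [iInf, Real.sInf_of_not_bddBelow hcon] at hc
    exact hc.false
  set γ := ⨅ k, c k
  have hγ : ∀ k, γ ≤ c k := fun k => ciInf_le hbelow k
  have hc0 : ∀ k, 0 < c k := fun k => hc.trans_le (hγ k)
  have hρ : ∀ k, ε / 2 ≤ ρ k := fun k => by nlinarith [h_eps k, sq_nonneg (ρ k)]
  have hρ0 : ∀ k, 0 ≤ ρ k := fun k => (half_pos hε0).le.trans (hρ k)
  -- `(1 - ρ)² ≤ 1 - ε ≤ (1 - ε / 2)²`.
  have hρ1 : ∀ k, |1 - ρ k| ≤ 1 - ε / 2 := fun k =>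
    abs_le_of_sq_le_sq (by nlinarith [h_eps k, sq_nonneg ε]) (by linarith [hε.2])
  obtain ⟨M, hM⟩ := exists_norm_le_of_relaxation (half_pos hε0) hρ1
    (fun k => mem_closedBall_zero_iff.1 (hB k)) h_p
  have hsub : ∀ k, (s (k + 1), pbar k) ∈ subdifferential F (x (k + 1)) (u (k + 1)) := by
    intro k
    obtain ⟨g, hg, v, hv, he⟩ := Set.mem_add.1 (h_min k)
    rw [Set.mem_singleton_iff] at hv
    subst hv
    have hg' : g = (s (k + 1), pbar k) := by
      rw [eq_sub_of_add_eq he, h_pbar]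
      simp
    rwa [← hg']
  have h_p' : ∀ k, p (k + 1) = p k - (ρ k * c k) • u (k + 1) := by
    intro k
    rw [h_p, h_pbar]
    module
  -- The weights `l k = ρ k * c k` and their partial sums.
  set l : ℕ → ℝ := fun k => ρ k * c k
  have hl : ∀ k, ε / 2 * γ ≤ l k := fun k => mul_le_mul (hρ k) (hγ k) hc.le (hρ0 k)
  have hlpos : ∀ k, 0 < l k := fun k => (mul_pos (half_pos hε0) hc).trans_le (hl k)
  set Λ : ℕ → ℝ := fun N => ∑ k ∈ Finset.range (N + 1), l k
  have hΛpos : ∀ N, 0 < Λ N := fun N =>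
    Finset.sum_pos (fun k _ => hlpos k) Finset.nonempty_range_add_one
  have hΛ : Filter.Tendsto (fun N => (Λ N)⁻¹) Filter.atTop (nhds 0) := by
    refine Filter.Tendsto.inv_tendsto_atTop
      (Filter.tendsto_atTop_mono (f := fun N : ℕ => (N : ℝ) * (ε / 2 * γ)) (fun N => ?_)
      (tendsto_natCast_atTop_atTop.atTop_mul_const (mul_pos (half_pos hε0) hc)))
    calc (N : ℝ) * (ε / 2 * γ) ≤ ((N + 1 : ℕ) : ℝ) * (ε / 2 * γ) := by
          gcongr
          exact N.le_succ
      _ ≤ Λ N := by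
          simpa using Finset.card_nsmul_le_sum (Finset.range (N + 1)) l _ fun k _ => hl k
  set X := fun N => (Finset.range (N + 1)).centerMass l fun k => x (k + 1)
  set U := fun N => (Finset.range (N + 1)).centerMass l fun k => u (k + 1)
  set P := fun N => (Finset.range (N + 1)).centerMass l pbar
  have hX : ∀ N, X N ∈ Metric.closedBall 0 A := fun N =>
    (convex_closedBall _ _).centerMass_mem (fun k _ => (hlpos k).le) (hΛpos N) fun k _ => hA k
  have hP : ∀ N, P N ∈ Metric.closedBall 0 B := fun N =>
    (convex_closedBall _ _).centerMass_mem (fun k _ => (hlpos k).le) (hΛpos N) fun k _ => hB k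
  have hU : Filter.Tendsto U Filter.atTop (nhds 0) := by
    refine squeeze_zero_norm (a := fun N => (Λ N)⁻¹ * (2 * M)) (fun N => ?_)
      (by simpa using hΛ.mul_const (2 * M))
    have hs : ∑ k ∈ Finset.range (N + 1), l k • u (k + 1) = p 0 - p (N + 1) := by
      rw [← Finset.sum_range_sub']
      exact Finset.sum_congr rfl fun k _ => by rw [h_p' k, sub_sub_cancel]
    simp only [U, Finset.centerMass, hs]
    rw [norm_smul, Real.norm_of_nonneg (inv_nonneg.2 (hΛpos N).le)]
    refine mul_le_mul_of_nonneg_left ?_ (inv_nonneg.2 (hΛpos N).le)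
    linarith [norm_sub_le (p 0) (p (N + 1)), hM 0, hM (N + 1)]
  obtain ⟨⟨a, b⟩, -, φ, hφ, hlim⟩ :=
    ((isCompact_closedBall (0 : EuclideanSpace ℝ (Fin n)) A).prod
      (isCompact_closedBall (0 : EuclideanSpace ℝ (Fin m)) B)).tendsto_subseq
      (x := fun N => (X N, P N)) fun N => ⟨hX N, hP N⟩
  have hXa : Filter.Tendsto (X ∘ φ) Filter.atTop (nhds a) := hlim.fst_nhds
  have hPb : Filter.Tendsto (P ∘ φ) Filter.atTop (nhds b) := hlim.snd_nhds
  -- The subsequence is fixed before `x'` and `u'`, so one pair `(a, b)` serves every test point.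
  refine h_saddle ⟨a, b, isSaddlePointOn_lagrangian_of_mem_subdifferential fun x' u' => ?_⟩
  simp only [inner_zero_left, sub_zero, zero_add]
  obtain htop | htop := eq_or_ne (F (x', u')) ⊤
  · rw [htop]
    exact le_top
  have hr := (EReal.coe_toReal htop (hF.ne_bot _)).symm
  set r := (F (x', u')).toReal
  set D := ‖w 0 - x'‖ ^ 2 + ‖p 0‖ ^ 2
  have hsum : ∀ N, ∑ k ∈ Finset.range (N + 1),
      l k * (inner ℝ (s (k + 1)) (x (k + 1) - x') + inner ℝ (pbar k) (u (k + 1))) ≤ D / 2 := by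
    intro N
    have hk : ∀ k, l k * (inner ℝ (s (k + 1)) (x (k + 1) - x') + inner ℝ (pbar k) (u (k + 1)))
        ≤ (‖w k - x'‖ ^ 2 + ‖p k‖ ^ 2) / 2 - (‖w (k + 1) - x'‖ ^ 2 + ‖p (k + 1)‖ ^ 2) / 2 := by
      intro k
      have := norm_sq_add_norm_sq_step_le (p := p k) hε0.le (hc0 k) (hρ0 k) (h_approx k) x'
      rw [← h_w, ← h_p', ← h_pbar] at this
      linarith
    refine (Finset.sum_le_sum fun k _ => hk k).trans ?_
    rw [Finset.sum_range_sub' fun k => (‖w k - x'‖ ^ 2 + ‖p k‖ ^ 2) / 2]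
    exact sub_le_self _ (by positivity)
  have hmem : ∀ N, F (X N, U N) ≤ ((r - inner ℝ (P N) u' + (Λ N)⁻¹ * (D / 2) : ℝ) : EReal) :=
    fun N => (hF.apply_centerMass_le (fun k _ => (hlpos k).le) (hΛpos N) hsub hr).trans <|
      EReal.coe_le_coe_iff.2 <| add_le_add_right
        (mul_le_mul_of_nonneg_left (hsum N) (inv_nonneg.2 (hΛpos N).le)) _
  have htend : Filter.Tendsto
      (fun N => ((X (φ N), U (φ N)), r - inner ℝ (P (φ N)) u' + (Λ (φ N))⁻¹ * (D / 2)))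
      Filter.atTop (nhds ((a, 0), r - inner ℝ b u' + 0 * (D / 2))) :=
    (hXa.prodMk_nhds (hU.comp hφ.tendsto_atTop)).prodMk_nhds
      ((tendsto_const_nhds.sub (hPb.inner tendsto_const_nhds)).add
        ((hΛ.comp hφ.tendsto_atTop).mul_const _))
  -- Closedness of the epigraph passes the averaged inequality to the limit.
  have hle : F (a, 0) ≤ ((r - inner ℝ b u' + 0 * (D / 2) : ℝ) : EReal) :=
    hF.lowerSemicontinuous.isClosed_real_epigraph.mem_of_tendsto htend
      (Filter.Eventually.of_forall fun N => hmem (φ N))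
  rw [zero_mul, add_zero, EReal.coe_sub] at hle
  rw [hr]
  exact EReal.le_sub_iff_add_le (.inl (EReal.coe_ne_bot _)) (.inl (EReal.coe_ne_top _)) |>.1 hle
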